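/- All graphs are finite, simple and undirected. The edges of a graph $G$ may be coloured arbitrarily (adjacent edges may receive the same colour); a path of an edge-coloured graph is called rainbow if no two of its edges have the same colour. The rainbow connection number $rc(G)$ of a connected graph $G$ is the least integer $k$ for which there is a colouring of the edges of $G$ with $k$ colours such that every two distinct vertices of $G$ are connected by a rainbow path. **Theorem 5.** Let $G$ be a bridgeless graph with $\mathrm{diam}(G)=3$ (in particular, $G$ is connected). If $G$ has an edge that is not contained in any triangle, then $rc(G)\leq 9$. -/

import Mathlib

namespace SimpleGraph

variable {V : Type*}

/-- A graph is bridgeless if none of its edges is a bridge. -/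
def IsBridgeless (G : SimpleGraph V) : Prop :=
  ∀ e ∈ G.edgeSet, ¬ G.IsBridge e

/-- A walk is rainbow, for a (not necessarily proper) colouring `c` of the edges of the graph,
if it is a path and no two of its edges have the same colour. -/
def Walk.IsRainbow {G : SimpleGraph V} {K : Type*} (c : G.EdgeLabeling K) {x y : V}
    (p : G.Walk x y) : Prop :=
  p.IsPath ∧ (p.darts.map fun d => c ⟨d.edge, d.edge_mem⟩).Nodup

/-- A rainbow edge-colouring: every two distinct vertices are connected by a rainbow path. -/
def EdgeLabeling.IsRainbow {G : SimpleGraph V} {K : Type*} (c : G.EdgeLabeling K) : Prop :=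
  ∀ x y : V, x ≠ y → ∃ p : G.Walk x y, p.IsRainbow c

/-- The rainbow connection number: the least `k` for which there is a rainbow edge-colouring with
colours from a set of size `k`. It is `⊤` if there is no such `k`, for instance if the graph is
disconnected. -/
noncomputable def rainbowConnectionNumber (G : SimpleGraph V) : ℕ∞ :=
  ⨅ k ∈ {k : ℕ | ∃ c : G.EdgeLabeling (Fin k), c.IsRainbow}, (k : ℕ∞)

end SimpleGraph

/-! ### Rainbow walks to the two ends of an edge -/

namespace SimpleGraph

variable {V : Type*}

/-! Let `uv` be an edge in no triangle, coloured 0. It suffices that every other vertex has a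
threshold t with one rainbow walk to {u, v} in the colours 1..t and another in t+1..8. Given two
vertices with thresholds t ≤ s, take the low walk of the first and the high walk of the second,
joined through `uv` if they end differently (`rainbowConnectionNumber_le_nine_of_cut`).

The other neighbours of u and of v form disjoint classes, and `Layer` sorts the remaining vertices
by their adjacency to these. Most edges get a colour determined by the classes of their ends, so
that low walks usually lead to u and high ones to v. This may fail for vertices of `a` with
neighbours only in `a` and u, for `zb`, for their mirror images, and for vertices of `x` with no
neighbour in `zg` or `wg`. For these some edges are switched to the mirrored colour. A bridgeless
graph has no vertex of degree one, and a maximal independent set (`exists_marking`) chooses the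
switches so that each such vertex has both kinds of walk itself or gets the missing one from a
neighbour.

A vertex of `zb` with no neighbour in `zg` needs an exit through `a`; the distance bound provides it
(`zb_near_b`, `zb_near_wb`). The colouring is nearly symmetric under `flipColor`, so
`Layering.sideCut` serves both sides. -/

/-- `G.ColorReach c D S x`: there is a walk from `x` to a vertex of `D` whose edges have distinct
`c`-colours, all in `S`. -/
def ColorReach {K : Type*} (G : SimpleGraph V) (c : V → V → K) (D : Set V) (S : Finset K) (x : V) :
    Prop :=
  ∃ y ∈ D, ∃ p : G.Walk x y, (p.darts.map fun d => c d.fst d.snd).Nodup ∧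
    ∀ d ∈ p.darts, c d.fst d.snd ∈ S

namespace ColorReach

variable {K : Type*} {G : SimpleGraph V} {c : V → V → K} {D : Set V} {S T : Finset K} {x y : V}

lemma refl (h : x ∈ D) : G.ColorReach c D S x :=
  ⟨x, h, .nil, by simp, by simp⟩

lemma mono (h : G.ColorReach c D S x) (hST : S ⊆ T) : G.ColorReach c D T x := by
  obtain ⟨y, hy, p, hp, hpS⟩ := h
  exact ⟨y, hy, p, hp, fun d hd => hST (hpS d hd)⟩

lemma cons [DecidableEq K] (h : G.ColorReach c D S y) (hxy : G.Adj x y) {k : K} (hc : c x y = k)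
    (hk : k ∉ S) (hT : insert k S ⊆ T) : G.ColorReach c D T x := by
  obtain ⟨z, hz, p, hp, hpS⟩ := h
  subst hc
  refine ⟨z, hz, .cons hxy p, ?_, ?_⟩
  · simp only [Walk.darts_cons, List.map_cons, List.nodup_cons]
    refine ⟨fun hmem => ?_, hp⟩
    obtain ⟨d, hd, hdc⟩ := List.mem_map.1 hmem
    exact hk (hdc ▸ hpS d hd)
  · intro d hd
    rw [Walk.darts_cons, List.mem_cons] at hd
    rcases hd with rfl | hd
    · exact hT (Finset.mem_insert_self _ _)
    · exact hT (Finset.mem_insert_of_mem (hpS d hd))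

lemma comp_iff [DecidableEq K] {σ : K → K} (hσ : σ.Involutive) :
    G.ColorReach (fun p q => σ (c p q)) D S x ↔ G.ColorReach c D (S.image σ) x := by
  refine exists_congr fun y => and_congr_right fun _ => exists_congr fun p => and_congr ?_ ?_
  · have : (p.darts.map fun d => σ (c d.fst d.snd)) =
        (p.darts.map fun d => c d.fst d.snd).map σ := by simp
    rw [this, List.nodup_map_iff hσ.injective]
  · refine forall₂_congr fun d _ => ?_
    rw [Finset.mem_image]
    exact ⟨fun h => ⟨_, h, hσ _⟩, fun ⟨k, hk, h⟩ => by
      simpa only [← h, hσ k] using hk⟩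

end ColorReach

/-- If every vertex other than `u` and `v` reaches `{u, v}` by a rainbow walk with colours in
`1, …, t` and by one with colours in `t + 1, …, 8`, and `uv` has colour `0`, then the
colouring is rainbow. -/
lemma rainbowConnectionNumber_le_nine_of_cut (G : SimpleGraph V) {u v : V} (huv : G.Adj u v)
    (c : V → V → Fin 9) (hsymm : ∀ x y, c x y = c y x) (h0 : c u v = 0)
    (hcut : ∀ x, x ≠ u → x ≠ v → ∃ t : Fin 9, G.ColorReach c {u, v} (Finset.Ioc 0 t) x ∧
      G.ColorReach c {u, v} (Finset.Ioi t) x) :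
    G.rainbowConnectionNumber ≤ 9 := by
  classical
  have hcut' : ∀ x, ∃ t : Fin 9, G.ColorReach c {u, v} (Finset.Ioc 0 t) x ∧
      G.ColorReach c {u, v} (Finset.Ioi t) x := by
    intro x
    by_cases hu : x = u
    · exact ⟨0, .refl (by simp [hu]), .refl (by simp [hu])⟩
    by_cases hv : x = v
    · exact ⟨0, .refl (by simp [hv]), .refl (by simp [hv])⟩
    exact hcut x hu hv
  have key : ∀ (S T : Finset (Fin 9)), Disjoint S T → 0 ∉ S → 0 ∉ T → ∀ x y,
      G.ColorReach c {u, v} S x → G.ColorReach c {u, v} T y →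
      ∃ p : G.Walk x y, (p.darts.map fun d => c d.fst d.snd).Nodup := by
    rintro S T hST hS hT x y ⟨r, hr, p, hp, hpS⟩ ⟨s, hs, q, hq, hqT⟩
    have hqr : (q.reverse.darts.map fun d => c d.fst d.snd) =
        (q.darts.map fun d => c d.fst d.snd).reverse := by
      simp only [Walk.darts_reverse, List.map_reverse, List.map_map]
      congr 1
      exact List.map_congr_left fun d _ => hsymm _ _
    by_cases hrs : r = s
    · subst hrs
      refine ⟨p.append q.reverse, ?_⟩
      rw [Walk.darts_append, List.map_append, hqr, List.nodup_append]
      refine ⟨hp, List.nodup_reverse.2 hq, ?_⟩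
      rintro k hk k' hk' rfl
      rw [List.mem_reverse] at hk'
      obtain ⟨d, hd, rfl⟩ := List.mem_map.1 hk
      obtain ⟨d', hd', h⟩ := List.mem_map.1 hk'
      exact Finset.disjoint_left.1 hST (hpS d hd) (h ▸ hqT d' hd')
    · have hrs' : G.Adj r s ∧ c r s = 0 := by
        rcases hr with rfl | rfl <;> rcases hs with rfl | rfl
        · exact absurd rfl hrs
        · exact ⟨huv, h0⟩
        · exact ⟨huv.symm, by rw [hsymm, h0]⟩
        · exact absurd rfl hrs
      refine ⟨p.append (.cons hrs'.1 q.reverse), ?_⟩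
      rw [Walk.darts_append, List.map_append, Walk.darts_cons, List.map_cons, hqr,
        List.nodup_append, List.nodup_cons]
      refine ⟨hp, ⟨?_, List.nodup_reverse.2 hq⟩, ?_⟩
      · intro hk
        obtain ⟨d, hd, h⟩ := List.mem_map.1 (List.mem_reverse.1 hk)
        exact hT ((h.trans hrs'.2) ▸ hqT d hd)
      · rintro k hk k' hk' rfl
        obtain ⟨d, hd, rfl⟩ := List.mem_map.1 hk
        rcases List.mem_cons.1 hk' with h | hk'
        · exact hS ((h.trans hrs'.2) ▸ hpS d hd)
        · obtain ⟨d', hd', h⟩ := List.mem_map.1 (List.mem_reverse.1 hk')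
          exact Finset.disjoint_left.1 hST (hpS d hd) (h ▸ hqT d' hd')
  have hwalk : ∀ x y, ∃ p : G.Walk x y, (p.darts.map fun d => c d.fst d.snd).Nodup := by
    intro x y
    obtain ⟨t, ht, ht'⟩ := hcut' x
    obtain ⟨s, hs, hs'⟩ := hcut' y
    rcases le_total t s with hts | hts
    · refine key _ _ ?_ (by simp) (by simp) x y ht hs'
      rw [Finset.disjoint_left]
      intro k hk hk'
      simp only [Finset.mem_Ioc, Finset.mem_Ioi] at hk hk'
      exact absurd (hk.2.trans hts) (not_le.2 hk')
    · refine key _ _ ?_ (by simp) (by simp) x y ht' hs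
      rw [Finset.disjoint_left]
      intro k hk hk'
      simp only [Finset.mem_Ioc, Finset.mem_Ioi] at hk hk'
      exact absurd (hk'.2.trans hts) (not_le.2 hk)
  refine iInf₂_le (9 : ℕ) ⟨EdgeLabeling.mk (fun x y _ => c x y) (fun x y _ => hsymm y x), ?_⟩
  intro x y _
  obtain ⟨p, hp⟩ := hwalk x y
  -- Shortcutting a walk to a path only deletes edges, so the colours stay distinct.
  refine ⟨p.bypass, p.bypass_isPath, ?_⟩
  have heq : (p.bypass.darts.map fun d => (EdgeLabeling.mk (G := G) (fun x y _ => c x y)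
      (fun x y _ => hsymm y x)) ⟨d.edge, d.edge_mem⟩) =
      p.bypass.darts.map fun d => c d.fst d.snd :=
    List.map_congr_left fun d _ => rfl
  rw [heq]
  exact hp.sublist (p.darts_bypass_sublist_darts.map _)

/-! ### Markings from maximal independent sets -/

/-- A partial two-colouring: `I` marks the vertices of `P` in such a way that every marked vertex
has a neighbour that is unmarked, in `P` or in `F`, and an unmarked vertex of `P` has only marked
neighbours in `P` and none in `F`. -/
lemma exists_marking [Finite V] (G : SimpleGraph V) (P F : Set V) :
    ∃ H ⊆ P, (∀ x ∈ H, ∃ y, G.Adj x y ∧ (y ∈ F ∨ y ∈ P ∧ y ∉ H)) ∧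
      ∀ x ∈ P, x ∉ H → ∀ y, G.Adj x y → y ∉ F ∧ (y ∈ P → y ∈ H) := by
  -- The unmarked vertices form a maximal independent set among the vertices of `P` without
  -- neighbours in `F`; maximality gives each marked vertex its unmarked neighbour.
  let Q : Set (Set V) :=
    {I | I ⊆ {x ∈ P | ∀ y, G.Adj x y → y ∉ F} ∧ ∀ x ∈ I, ∀ y ∈ I, ¬ G.Adj x y}
  obtain ⟨I, hI⟩ := (Set.toFinite Q).exists_maximal ⟨∅, by simp [Q]⟩
  refine ⟨P \ I, Set.sdiff_subset, ?_, ?_⟩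
  · rintro x ⟨hxP, hxI⟩
    by_contra! hno
    refine hxI (hI.2 (y := insert x I) ⟨?_, ?_⟩ (Set.subset_insert x I) (Set.mem_insert x I))
    · exact Set.insert_subset ⟨hxP, fun y hy => (hno y hy).1⟩ hI.1.1
    · have hx : ∀ y ∈ I, ¬ G.Adj x y := fun y hy hxy =>
        (((hno y hxy).2 (hI.1.1 hy).1).2) hy
      rintro a (rfl | ha) b (rfl | hb)
      · exact G.loopless.irrefl _
      · exact hx b hb
      · exact fun h => hx a ha h.symm
      · exact hI.1.2 a ha b hb
  · intro x hxP hx y hxy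
    have hxI : x ∈ I := by by_contra h; exact hx ⟨hxP, h⟩
    exact ⟨(hI.1.1 hxI).2 y hxy, fun hy => ⟨hy, fun hyI => hI.1.2 x hxI y hyI hxy⟩⟩

/-! ### Classes of vertices relative to the edge -/

/-- Labels for the classes of vertices relative to an edge `uv` that lies in no triangle: `a` and
`b` are the other neighbours of `u` and of `v`; of the remaining vertices, those of `y` have
neighbours in `a` and `b`, those of `zg`, `zb` only in `a`, those of `wg`, `wb` only in `b`, and
those of `x` in neither. A vertex is in `zb` if all its neighbours are in `a`, `zg`, `zb`. -/
inductive Layer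
  | u | v | a | b | y | zg | zb | wg | wb | x
  deriving DecidableEq

namespace Layer

/-- The involution on classes induced by exchanging `u` and `v`. -/
def swap : Layer → Layer
  | u => v | v => u | a => b | b => a | y => y
  | zg => wg | zb => wb | wg => zg | wb => zb | x => x

/-- The classes in which a vertex of a given class may have neighbours. -/
def compat : Layer → List Layer
  | u => [v, a]
  | v => [u, b]
  | a => [u, a, b, y, zg, zb]
  | b => [v, b, a, y, wg, wb]
  | y => [a, b, y, zg, wg, x]
  | zg => [a, y, zg, zb, wg, x]
  | zb => [a, zg, zb]
  | wg => [b, y, wg, wb, zg, x]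
  | wb => [b, wg, wb]
  | x => [y, zg, wg, x]

lemma swap_eq_iff (p q : Layer) : p.swap = q ↔ p = q.swap := by
  cases p <;> cases q <;> decide

lemma swap_u : u.swap = v := rfl

lemma swap_a : a.swap = b := rfl

lemma swap_b : b.swap = a := rfl

lemma swap_y : y.swap = y := rfl

lemma swap_zg : zg.swap = wg := rfl

lemma swap_zb : zb.swap = wb := rfl

lemma swap_mem_compat {p q : Layer} (h : q ∈ p.compat) : q.swap ∈ p.swap.compat := by
  revert h; cases p <;> cases q <;> decide

end Layer

/-- The properties of the classification of vertices by `Layer` that are used, for a graph with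
minimum degree at least two in which any two vertices are at distance at most three. -/
structure Layering (G : SimpleGraph V) (u v : V) (k : V → Layer) : Prop where
  u_iff : ∀ x, k x = .u ↔ x = u
  v_iff : ∀ x, k x = .v ↔ x = v
  adj_u : ∀ x, k x = .a → G.Adj x u
  adj_v : ∀ x, k x = .b → G.Adj x v
  toA : ∀ x, k x = .y ∨ k x = .zg ∨ k x = .zb → ∃ a, G.Adj x a ∧ k a = .a
  toB : ∀ x, k x = .y ∨ k x = .wg ∨ k x = .wb → ∃ b, G.Adj x b ∧ k b = .b
  x_near_u : ∀ x, k x = .x → ∃ p, G.Adj x p ∧ (k p = .y ∨ k p = .zg)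
  x_near_v : ∀ x, k x = .x → ∃ p, G.Adj x p ∧ (k p = .y ∨ k p = .wg)
  zg_adj : ∀ x, k x = .zg → ∃ p, G.Adj x p ∧ (k p = .y ∨ k p = .wg ∨ k p = .x)
  wg_adj : ∀ x, k x = .wg → ∃ p, G.Adj x p ∧ (k p = .y ∨ k p = .zg ∨ k p = .x)
  compat : ∀ p q, G.Adj p q → k q ∈ (k p).compat
  exists_ne : ∀ x y, G.Adj x y → ∃ z, z ≠ y ∧ G.Adj x z
  dist_le : ∀ x y, ∃ p q, (x = p ∨ G.Adj x p) ∧ (p = q ∨ G.Adj p q) ∧ (q = y ∨ G.Adj q y)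

namespace Layering

variable {G : SimpleGraph V} {u v : V} {k : V → Layer}

lemma swap (L : G.Layering u v k) : G.Layering v u fun x => (k x).swap where
  u_iff x := by rw [Layer.swap_eq_iff]; exact L.v_iff x
  v_iff x := by rw [Layer.swap_eq_iff]; exact L.u_iff x
  adj_u x := by rw [Layer.swap_eq_iff]; exact L.adj_v x
  adj_v x := by rw [Layer.swap_eq_iff]; exact L.adj_u x
  toA x := by simp only [Layer.swap_eq_iff]; exact L.toB x
  toB x := by simp only [Layer.swap_eq_iff]; exact L.toA x
  x_near_u x := by simp only [Layer.swap_eq_iff]; exact L.x_near_v x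
  x_near_v x := by simp only [Layer.swap_eq_iff]; exact L.x_near_u x
  zg_adj x := by simp only [Layer.swap_eq_iff]; exact L.wg_adj x
  wg_adj x := by simp only [Layer.swap_eq_iff]; exact L.zg_adj x
  compat p q h := Layer.swap_mem_compat (L.compat p q h)
  exists_ne := L.exists_ne
  dist_le := L.dist_le

lemma zb_adj (L : G.Layering u v k) {z q : V} (hz : k z = .zb) (h : G.Adj z q) :
    k q = .a ∨ k q = .zg ∨ k q = .zb := by
  simpa [hz, Layer.compat] using L.compat z q h

lemma wb_adj (L : G.Layering u v k) {z q : V} (hz : k z = .wb) (h : G.Adj z q) :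
    k q = .b ∨ k q = .wg ∨ k q = .wb := by
  simpa [hz, Layer.compat] using L.compat z q h

lemma a_adj (L : G.Layering u v k) {z q : V} (hz : k z = .a) (h : G.Adj z q) :
    k q = .u ∨ k q = .a ∨ k q = .b ∨ k q = .y ∨ k q = .zg ∨ k q = .zb := by
  simpa [hz, Layer.compat] using L.compat z q h

lemma x_adj (L : G.Layering u v k) {z q : V} (hz : k z = .x) (h : G.Adj z q) :
    k q = .y ∨ k q = .zg ∨ k q = .wg ∨ k q = .x := by
  simpa [hz, Layer.compat] using L.compat z q h

/-! ### Choosing the edges to recolour -/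

/-- Some vertices of class `a` can be marked so that those with neighbours outside `a` and `u` are
unmarked and every other one has a neighbour of class `a` that is marked differently. -/
lemma exists_marking_a [Finite V] (L : G.Layering u v k) : ∃ H : Set V,
    (∀ a, k a = .a → (∃ q, G.Adj a q ∧ k q ≠ .u ∧ k q ≠ .a) → a ∉ H) ∧
    ∀ a, k a = .a → (∀ q, G.Adj a q → k q = .u ∨ k q = .a) →
      ∃ a', k a' = .a ∧ G.Adj a a' ∧ (a ∈ H ∧ a' ∉ H ∨ a ∉ H ∧ a' ∈ H) := by
  obtain ⟨H, hHP, hH, hH'⟩ := G.exists_marking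
    {a | k a = .a ∧ ∀ q, G.Adj a q → k q = .u ∨ k q = .a}
    {a | k a = .a ∧ ¬ ∀ q, G.Adj a q → k q = .u ∨ k q = .a}
  refine ⟨H, ?_, ?_⟩
  · rintro a ha ⟨q, hq, hqu, hqa⟩ haH
    exact ((hHP haH).2 q hq).elim hqu hqa
  · intro a ha hnb
    by_cases haH : a ∈ H
    · obtain ⟨y, hay, hy⟩ := hH a haH
      rcases hy with ⟨hy, hy'⟩ | ⟨hy, hy'⟩
      · exact ⟨y, hy, hay, .inl ⟨haH, fun h => hy' (hHP h).2⟩⟩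
      · exact ⟨y, hy.1, hay, .inl ⟨haH, hy'⟩⟩
    · obtain ⟨q, hqu, haq⟩ := L.exists_ne a u (L.adj_u a ha)
      have hqa : k q = .a := (hnb q haq).resolve_left fun h => hqu ((L.u_iff q).1 h)
      obtain ⟨hF, hP⟩ := hH' a ⟨ha, hnb⟩ haH q haq
      refine ⟨q, hqa, haq, .inr ⟨haH, hP ⟨hqa, ?_⟩⟩⟩
      by_contra h
      exact hF ⟨hqa, h⟩

/-- Some edges between `zb` and `A` can be marked so that every vertex of `zb` has both an unmarked
edge to the class `a` and a marked one, or has one of them and a suitable neighbour. -/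
lemma exists_marking_zb [Finite V] (L : G.Layering u v k) (A : Set V)
    (hT : ∀ z, k z = .zb → (∀ q, G.Adj z q → k q ≠ .zg) →
      (∃ a ∈ A, G.Adj z a) ∨ ∃ y, k y = .zb ∧ G.Adj z y ∧ ∃ a ∈ A, G.Adj y a) :
    ∃ E : V → V → Prop, (∀ z a, E z a → a ∈ A) ∧
      ∀ z, k z = .zb →
        ((∃ a, k a = .a ∧ G.Adj z a ∧ ¬ E z a) ∧ ∃ a, G.Adj z a ∧ E z a) ∨
        ((∃ a, G.Adj z a ∧ E z a) ∧
          ∃ y, k y = .zb ∧ G.Adj z y ∧ ∃ a, k a = .a ∧ G.Adj y a ∧ ¬ E y a) ∨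
        ((∃ a, k a = .a ∧ G.Adj z a ∧ ¬ E z a) ∧ ∃ q, G.Adj z q ∧ k q = .zg) ∨
        ((∃ a, k a = .a ∧ G.Adj z a ∧ ¬ E z a) ∧
          ∃ y, k y = .zb ∧ G.Adj z y ∧ ∃ a, G.Adj y a ∧ E y a) := by
  let M : Set V := {z | k z = .zb ∧ ∃ a ∈ A, G.Adj z a}
  have hf : ∀ z, ∃ a, z ∈ M → a ∈ A ∧ G.Adj z a := by
    intro z
    by_cases hz : z ∈ M
    · obtain ⟨a, ha⟩ := hz.2
      exact ⟨a, fun _ => ha⟩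
    · exact ⟨z, fun h => absurd h hz⟩
  choose f hf using hf
  -- Only vertices whose sole neighbour in `a` is `f z` face a choice. Vertices of `zb` outside `M`
  -- have only unmarked edges, so they play the role of `F`.
  let P : Set V := {z | z ∈ M ∧ ∀ a, k a = .a → G.Adj z a → a = f z}
  obtain ⟨H, hHP, hH, hH'⟩ := G.exists_marking P {z | k z = .zb ∧ z ∉ M}
  let E : V → V → Prop := fun z a => z ∈ M ∧ a = f z ∧ (z ∈ H ∨ z ∉ P)
  have hi : ∀ z, z ∈ M → (z ∈ P → z ∈ H) → ∃ a, G.Adj z a ∧ E z a := fun z hz h =>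
    ⟨f z, (hf z hz).2, hz, rfl, by tauto⟩
  have lo : ∀ z, k z = .zb → (z ∈ M → z ∉ H) → ∃ a, k a = .a ∧ G.Adj z a ∧ ¬ E z a := by
    intro z hz h
    by_cases hzP : z ∈ M ∧ z ∉ P
    · obtain ⟨a, ha, hza, hne⟩ : ∃ a, k a = .a ∧ G.Adj z a ∧ a ≠ f z := by
        by_contra! hno
        exact hzP.2 ⟨hzP.1, hno⟩
      exact ⟨a, ha, hza, fun hE => hne hE.2.1⟩
    · obtain ⟨a, hza, ha⟩ := L.toA z (.inr (.inr hz))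
      exact ⟨a, ha, hza, fun hE => hE.2.2.elim (h hE.1) fun h' => hzP ⟨hE.1, h'⟩⟩
  refine ⟨E, fun z a h => h.2.1 ▸ (hf z h.1).1, fun z hz => ?_⟩
  by_cases hzM : z ∈ M
  · by_cases hzP : z ∈ P
    · by_cases hzH : z ∈ H
      · obtain ⟨y, hzy, hy⟩ := hH z hzH
        refine .inr (.inl ⟨hi z hzM fun _ => hzH, y, ?_⟩)
        rcases hy with hy | hy
        · exact ⟨hy.1, hzy, lo y hy.1 fun h => absurd h hy.2⟩
        · exact ⟨hy.1.1.1, hzy, lo y hy.1.1.1 fun _ => hy.2⟩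
      · have hlo := lo z hz fun _ => hzH
        obtain ⟨q, hqf, hzq⟩ := L.exists_ne z (f z) (hf z hzM).2
        rcases L.zb_adj hz hzq with hq | hq | hq
        · exact absurd (hzP.2 q hq hzq) hqf
        · exact .inr (.inr (.inl ⟨hlo, q, hzq, hq⟩))
        · obtain ⟨hF, hP⟩ := hH' z hzP hzH q hzq
          have hqM : q ∈ M := by
            by_contra h
            exact hF ⟨hq, h⟩
          exact .inr (.inr (.inr ⟨hlo, q, hq, hzq, hi q hqM hP⟩))
    · exact .inl ⟨lo z hz fun _ h => hzP (hHP h), hi z hzM fun h => absurd h hzP⟩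
  · have hlo := lo z hz fun h => absurd h hzM
    by_cases hzg : ∃ q, G.Adj z q ∧ k q = .zg
    · exact .inr (.inr (.inl ⟨hlo, hzg⟩))
    · push Not at hzg
      rcases hT z hz hzg with h | ⟨y, hy, hzy, ha⟩
      · exact absurd ⟨hz, h⟩ hzM
      · refine .inr (.inr (.inr ⟨hlo, y, hy, hzy, hi y ⟨hy, ha⟩ fun hyP => ?_⟩))
        by_contra hyH
        exact (hH' y hyP hyH z hzy.symm).1 ⟨hz, hzM⟩

/-- Some edges between the classes `x` and `y` can be marked so that every vertex of `x` has both
a marked and an unmarked one or a suitable replacement. -/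
lemma exists_marking_x [Finite V] (L : G.Layering u v k) : ∃ E : V → V → Prop,
    (∀ x, (∃ q, G.Adj x q ∧ k q = .zg) → ∀ y, E x y) ∧
    (∀ x, (∃ q, G.Adj x q ∧ k q = .wg) → (¬ ∃ q, G.Adj x q ∧ k q = .zg) → ∀ y, ¬ E x y) ∧
    ∀ x, k x = .x → (¬ ∃ q, G.Adj x q ∧ k q = .zg) → (¬ ∃ q, G.Adj x q ∧ k q = .wg) →
      ((∃ y, k y = .y ∧ G.Adj x y ∧ ¬ E x y) ∧ ∃ y, k y = .y ∧ G.Adj x y ∧ E x y) ∨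
      ((∃ y, k y = .y ∧ G.Adj x y ∧ E x y) ∧
        ∃ x', k x' = .x ∧ G.Adj x x' ∧ ∃ y, k y = .y ∧ G.Adj x' y ∧ ¬ E x' y) ∨
      ((∃ y, k y = .y ∧ G.Adj x y ∧ ¬ E x y) ∧
        ∃ x', k x' = .x ∧ G.Adj x x' ∧ ((∃ y, k y = .y ∧ G.Adj x' y ∧ E x' y) ∨
          (∃ q, G.Adj x' q ∧ k q = .zg) ∨ ∃ q, G.Adj x' q ∧ k q = .wg)) := by
  let Z : Set V := {x | ∃ q, G.Adj x q ∧ k q = .zg}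
  let W : Set V := {x | ∃ q, G.Adj x q ∧ k q = .wg}
  have hg : ∀ x, ∃ y, k x = .x → x ∉ Z → k y = .y ∧ G.Adj x y := by
    intro x
    by_cases hx : k x = .x ∧ x ∉ Z
    · obtain ⟨p, hxp, hp⟩ := L.x_near_u x hx.1
      exact ⟨p, fun _ _ => ⟨hp.resolve_right fun h => hx.2 ⟨p, hxp, h⟩, hxp⟩⟩
    · exact ⟨x, fun h h' => absurd ⟨h, h'⟩ hx⟩
  choose g hg using hg
  let P : Set V := {x | k x = .x ∧ x ∉ Z ∧ x ∉ W ∧ ∀ y, k y = .y → G.Adj x y → y = g x}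
  obtain ⟨H, hHP, hH, hH'⟩ := G.exists_marking P ∅
  -- A neighbour in `zg` yields a low walk, so the edges to `y` serve the high one; for a neighbour
  -- in `wg` only, it is the reverse.
  let E : V → V → Prop := fun x y => x ∈ Z ∨ x ∉ W ∧ y = g x ∧ (x ∈ H ∨ x ∉ P)
  have hi : ∀ x, k x = .x → x ∉ Z → x ∉ W → (x ∈ P → x ∈ H) →
      ∃ y, k y = .y ∧ G.Adj x y ∧ E x y := fun x hx hZ hW h =>
    ⟨g x, (hg x hx hZ).1, (hg x hx hZ).2, .inr ⟨hW, rfl, by tauto⟩⟩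
  have lo : ∀ x ∈ P, x ∉ H → ∃ y, k y = .y ∧ G.Adj x y ∧ ¬ E x y := fun x hx hxH =>
    ⟨g x, (hg x hx.1 hx.2.1).1, (hg x hx.1 hx.2.1).2, fun h =>
      h.elim hx.2.1 fun h => h.2.2.elim hxH fun h => h hx⟩
  refine ⟨E, fun x hx y => .inl hx, fun x hW hZ y hE => hE.elim hZ fun h => h.1 hW,
    fun x hx hZ hW => ?_⟩
  by_cases hxP : x ∈ P
  · by_cases hxH : x ∈ H
    · obtain ⟨y, hxy, hy⟩ := hH x hxH
      have hy := hy.resolve_left (Set.notMem_empty y)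
      exact .inr (.inl ⟨hi x hx hZ hW fun _ => hxH, y, hy.1.1, hxy, lo y hy.1 hy.2⟩)
    · refine .inr (.inr ⟨lo x hxP hxH, ?_⟩)
      obtain ⟨q, hqg, hxq⟩ := L.exists_ne x (g x) (hg x hx hZ).2
      rcases L.x_adj hx hxq with hq | hq | hq | hq
      · exact absurd (hxP.2.2.2 q hq hxq) hqg
      · exact absurd ⟨q, hxq, hq⟩ hZ
      · exact absurd ⟨q, hxq, hq⟩ hW
      · refine ⟨q, hq, hxq, ?_⟩
        by_cases hqZ : q ∈ Z
        · exact .inr (.inl hqZ)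
        by_cases hqW : q ∈ W
        · exact .inr (.inr hqW)
        exact .inl (hi q hq hqZ hqW (hH' x hxP hxH q hxq).2)
  · refine .inl ⟨?_, hi x hx hZ hW fun h => absurd h hxP⟩
    obtain ⟨y, hy, hxy, hne⟩ : ∃ y, k y = .y ∧ G.Adj x y ∧ y ≠ g x := by
      by_contra! hno
      exact hxP ⟨hx, hZ, hW, hno⟩
    exact ⟨y, hy, hxy, fun h => h.elim hZ fun h => hne h.2.1⟩

/-! ### Exits forced by the distance bound -/

/-- A vertex of `zb` without neighbours in `zg` has a short connection to the class `b`. -/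
lemma zb_near_b (L : G.Layering u v k) {z b : V} (hz : k z = .zb)
    (hzg : ∀ q, G.Adj z q → k q ≠ .zg) (hb : k b = .b) :
    (∃ a, k a = .a ∧ G.Adj z a ∧ ((∃ q, G.Adj a q ∧ (k q = .b ∨ k q = .y)) ∨
      ∃ a', k a' = .a ∧ G.Adj a a' ∧ ∃ q, G.Adj a' q ∧ k q = .b)) ∨
    ∃ y, k y = .zb ∧ G.Adj z y ∧ ∃ a, k a = .a ∧ G.Adj y a ∧ ∃ q, G.Adj a q ∧ k q = .b := by
  obtain ⟨p, q, hzp, hpq, hqb⟩ := L.dist_le z b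
  have hstep : ∀ q, (q = b ∨ G.Adj q b) → k q ≠ .zb ∧ k q ≠ .zg ∧ k q ≠ .u := by
    rintro q (rfl | h)
    · simp [hb]
    · have := L.compat q b h
      rw [hb] at this
      refine ⟨?_, ?_, ?_⟩ <;> intro h <;> simp [h, Layer.compat] at this
  have hq := hstep q hqb
  have hzb : ∀ p, k p = .zb → G.Adj p q → k q = .a ∧ G.Adj q b := by
    intro p hp hpq
    have hqa : k q = .a := by rcases L.zb_adj hp hpq with h | h | h <;> simp_all
    exact ⟨hqa, hqb.resolve_left fun h => by simp_all⟩
  rcases hzp with rfl | hzp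
  · rcases hpq with rfl | hpq
    · exact absurd hz hq.1
    · obtain ⟨hqa, hqb⟩ := hzb z hz hpq
      exact .inl ⟨q, hqa, hpq, .inl ⟨b, hqb, .inl hb⟩⟩
  · rcases L.zb_adj hz hzp with hp | hp | hp
    · refine .inl ⟨p, hp, hzp, ?_⟩
      rcases hpq with rfl | hpq
      · exact .inl ⟨b, hqb.resolve_left fun h => by simp_all, .inl hb⟩
      · rcases L.a_adj hp hpq with h | h | h | h | h | h
        · exact absurd h hq.2.2
        · exact .inr ⟨q, h, hpq, b, hqb.resolve_left fun h => by simp_all, hb⟩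
        · exact .inl ⟨q, hpq, .inl h⟩
        · exact .inl ⟨q, hpq, .inr h⟩
        · exact absurd h hq.2.1
        · exact absurd h hq.1
    · exact absurd hp (hzg p hzp)
    · rcases hpq with rfl | hpq
      · exact absurd hp hq.1
      · obtain ⟨hqa, hqb⟩ := hzb p hp hpq
        exact .inr ⟨p, hp, hzp, q, hqa, hpq, b, hqb, hb⟩

/-- Vertices of `zb` and `wb` without neighbours in `zg` and `wg`, respectively, are connected
through an edge between the classes `a` and `b`. -/
lemma zb_near_wb (L : G.Layering u v k) {z w : V} (hz : k z = .zb)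
    (hzg : ∀ q, G.Adj z q → k q ≠ .zg) (hw : k w = .wb) (hwg : ∀ q, G.Adj w q → k q ≠ .wg) :
    ∃ a b, k a = .a ∧ k b = .b ∧ G.Adj z a ∧ G.Adj a b ∧ G.Adj w b := by
  obtain ⟨p, q, hzp, hpq, hqw⟩ := L.dist_le z w
  have hp : k p = .zb ∨ k p = .a ∧ G.Adj z p := by
    rcases hzp with rfl | hzp
    · exact .inl hz
    · rcases L.zb_adj hz hzp with h | h | h
      · exact .inr ⟨h, hzp⟩
      · exact absurd h (hzg p hzp)
      · exact .inl h
  have hq : k q = .wb ∨ k q = .b ∧ G.Adj w q := by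
    rcases hqw with rfl | hqw
    · exact .inl hw
    · rcases L.wb_adj hw hqw.symm with h | h | h
      · exact .inr ⟨h, hqw.symm⟩
      · exact absurd h (hwg q hqw.symm)
      · exact .inl h
  have hpq' : G.Adj p q := hpq.resolve_left fun h => by
    subst h
    rcases hp with hp | hp <;> rcases hq with hq | hq <;> simp_all
  have := L.compat p q hpq'
  rcases hp with hp | hp <;> rcases hq with hq | hq <;> simp [hp, hq, Layer.compat] at this
  exact ⟨p, q, hp.1, hq.1, hp.2, hpq', hq.2⟩

end Layering

/-! ### The colouring and one side of its verification -/

/-- The involution of the nine colours that exchanges the roles of `u` and `v`. -/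
def flipColor : Fin 9 → Fin 9 := ![0, 8, 7, 6, 4, 5, 3, 2, 1]

lemma flipColor_involutive : Function.Involutive flipColor := by
  intro k; revert k; decide

/-- The default colour of an edge between two classes. -/
def Layer.color : Layer → Layer → Fin 9
  | .u, .a | .a, .u => 1
  | .v, .b | .b, .v => 8
  | .a, .a | .b, .b => 5
  | .a, .b | .b, .a => 4
  | .a, .y | .y, .a => 4
  | .b, .y | .y, .b => 6
  | .a, .zg | .zg, .a | .a, .zb | .zb, .a => 2
  | .b, .wg | .wg, .b | .b, .wb | .wb, .b => 7
  | .zb, .zb => 3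
  | .wb, .wb => 6
  | .zb, .zg | .zg, .zb | .wb, .wg | .wg, .wb => 5
  | .zg, .wg | .wg, .zg => 4
  | .zg, .y | .y, .zg => 3
  | .wg, .y | .y, .wg => 6
  | .x, .zg | .zg, .x => 3
  | .x, .wg | .wg, .x => 6
  | .x, .y | .y, .x => 2
  | .x, .x => 5
  -- Apart from `uv`, this concerns only edges inside `y`, `zg` or `wg`, which the walks never use;
  -- the remaining pairs of classes span no edge.
  | _, _ => 0

lemma Layer.color_comm (p q : Layer) : p.color q = q.color p := by
  cases p <;> cases q <;> rfl

/-- A vertex with rainbow walks to `D` in the colours `1, …, t` and `t + 1, …, 8`. The values of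
`t` are those for which `flipColor` exchanges the two kinds of colours for `t` and another such
value. -/
def SideCut (G : SimpleGraph V) (c : V → V → Fin 9) (D : Set V) (x : V) : Prop :=
  ∃ t ∈ ({1, 2, 3, 5, 6, 7} : Finset (Fin 9)),
    G.ColorReach c D (Finset.Ioc 0 t) x ∧ G.ColorReach c D (Finset.Ioi t) x

/-- For the admissible t, `flipColor` exchanges 1..t with the colours above 8 - t. It fixes 4 and 5,
which is why t = 4 is not admissible. -/
lemma SideCut.of_flip {G : SimpleGraph V} {c : V → V → Fin 9} {D : Set V} {x : V}
    (h : G.SideCut (fun p q => flipColor (c p q)) D x) : G.SideCut c D x := by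
  obtain ⟨t, ht, h1, h2⟩ := h
  rw [ColorReach.comp_iff flipColor_involutive] at h1 h2
  refine ⟨8 - t, ?_, h2.mono ?_, h1.mono ?_⟩ <;> clear h1 h2 <;> revert t <;> decide

namespace Layering

variable {G : SimpleGraph V} {u v : V} {k : V → Layer}

/-- The vertices of the classes `a`, `zg` and `zb` have the required rainbow walks, given some of
those through the other classes. -/
lemma sideCut (L : G.Layering u v k) {c : V → V → Fin 9} (hc : ∀ x y, c x y = c y x) {D : Set V}
    (hu : u ∈ D) {A : Set V}
    (hau : ∀ a, k a = .a → (∃ q, G.Adj a q ∧ k q ≠ .u ∧ k q ≠ .a) → c a u = 1)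
    (hau' : ∀ a, k a = .a → (∀ q, G.Adj a q → k q = .u ∨ k q = .a) →
      ∃ a', k a' = .a ∧ G.Adj a a' ∧ (c a u = 8 ∧ c a' u = 1 ∨ c a u = 1 ∧ c a' u = 8))
    (haa : ∀ p q, k p = .a → k q = .a → c p q = 5)
    (hzga : ∀ p q, k p = .zg → k q = .a → c p q = 2)
    (hzbzb : ∀ p q, k p = .zb → k q = .zb → c p q = 3)
    (hzbzg : ∀ p q, k p = .zb → k q = .zg → c p q = 5)
    (hzba : ∀ p q, k p = .zb → k q = .a → q ∉ A → c p q = 2)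
    (hzb : ∀ z, k z = .zb →
        ((∃ a, k a = .a ∧ G.Adj z a ∧ c z a = 2) ∧ ∃ a ∈ A, G.Adj z a ∧ c z a = 7) ∨
        ((∃ a ∈ A, G.Adj z a ∧ c z a = 7) ∧
          ∃ y, k y = .zb ∧ G.Adj z y ∧ ∃ a, k a = .a ∧ G.Adj y a ∧ c y a = 2) ∨
        ((∃ a, k a = .a ∧ G.Adj z a ∧ c z a = 2) ∧ ∃ q, G.Adj z q ∧ k q = .zg) ∨
        ((∃ a, k a = .a ∧ G.Adj z a ∧ c z a = 2) ∧
          ∃ y, k y = .zb ∧ G.Adj z y ∧ ∃ a ∈ A, G.Adj y a ∧ c y a = 7))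
    (ha : ∀ a, k a = .a → (∃ q, G.Adj a q ∧ (k q = .b ∨ k q = .y)) →
      G.ColorReach c D {2, 3, 4, 5, 6, 7, 8} a)
    (hA : ∀ a ∈ A, G.ColorReach c D {4, 5, 6, 8} a)
    (hzg : ∀ z, k z = .zg → G.ColorReach c D {3, 4, 6, 7, 8} z) :
    ∀ x, k x = .a ∨ k x = .zg ∨ k x = .zb → G.SideCut c D x := by
  have a_lo : ∀ a, k a = .a → (∃ q, G.Adj a q ∧ k q ≠ .u ∧ k q ≠ .a) →
      G.ColorReach c D {1} a := fun a h hq =>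
    (ColorReach.refl hu (S := ∅)).cons (L.adj_u a h) (hau a h hq) (by decide) (by decide)
  have z_lo : ∀ z a, k z = .zg ∨ k z = .zb → k a = .a → G.Adj z a → c z a = 2 →
      G.ColorReach c D {1, 2} z := fun z a hz h hza hca =>
    (a_lo a h ⟨z, hza.symm, by rcases hz with hz | hz <;> simp [hz]⟩).cons hza hca
      (by decide) (by decide)
  have z_hi : ∀ z, (∃ a ∈ A, G.Adj z a ∧ c z a = 7) → G.ColorReach c D {4, 5, 6, 7, 8} z := by
    rintro z ⟨a, haA, hza, hca⟩
    exact (hA a haA).cons hza hca (by decide) (by decide)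
  have zb_hi : ∀ z, k z = .zb → (∃ a, k a = .a ∧ G.Adj z a ∧ c z a = 2) →
      G.ColorReach c D {3, 4, 5, 6, 7, 8} z := by
    intro z hz hlo
    have hlohi : (∃ a ∈ A, G.Adj z a ∧ c z a = 7) → G.ColorReach c D {3, 4, 5, 6, 7, 8} z :=
      fun h => (z_hi z h).mono (by decide)
    rcases hzb z hz with h | h | h | h
    · exact hlohi h.2
    · exact hlohi h.1
    · obtain ⟨q, hzq, hq⟩ := h.2
      exact (hzg q hq).cons hzq (hzbzg z q hz hq) (by decide) (by decide)
    · obtain ⟨y, hy, hzy, h⟩ := h.2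
      exact (z_hi y h).cons hzy (hzbzb z y hz hy) (by decide) (by decide)
  rintro x (hx | hx | hx)
  · by_cases hnb : ∀ q, G.Adj x q → k q = .u ∨ k q = .a
    · obtain ⟨a', ha', hxa, ⟨h1, h2⟩ | ⟨h1, h2⟩⟩ := hau' x hx hnb
      · refine ⟨7, by decide, ?_, (ColorReach.refl hu (S := ∅)).cons (L.adj_u x hx) h1
          (by decide) (by decide)⟩
        exact ((ColorReach.refl hu (S := ∅)).cons (T := {1}) (L.adj_u a' ha') h2
          (by decide) (by decide)).cons hxa (haa x a' hx ha') (by decide) (by decide)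
      · refine ⟨1, by decide, (ColorReach.refl hu (S := ∅)).cons (L.adj_u x hx) h1
          (by decide) (by decide), ?_⟩
        exact ((ColorReach.refl hu (S := ∅)).cons (T := {8}) (L.adj_u a' ha') h2
          (by decide) (by decide)).cons hxa (haa x a' hx ha') (by decide) (by decide)
    · push Not at hnb
      refine ⟨1, by decide, (a_lo x hx hnb).mono (by decide), ?_⟩
      obtain ⟨q, hxq, hqu, hqa⟩ := hnb
      rcases L.a_adj hx hxq with h | h | h | h | h | h
      · exact absurd h hqu
      · exact absurd h hqa
      · exact (ha x hx ⟨q, hxq, .inl h⟩).mono (by decide)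
      · exact (ha x hx ⟨q, hxq, .inr h⟩).mono (by decide)
      · exact (hzg q h).cons hxq ((hc x q).trans (hzga q x h hx)) (by decide) (by decide)
      -- Outside `A` the edge to `q` is unmarked, of colour 2, which the high walk of `q` avoids.
      · by_cases hxA : x ∈ A
        · exact (hA x hxA).mono (by decide)
        · have h2 := hzba q x h hx hxA
          exact (zb_hi q h ⟨x, hx, hxq.symm, h2⟩).cons hxq ((hc x q).trans h2)
            (by decide) (by decide)
  · obtain ⟨a, hxa, ha⟩ := L.toA x (.inr (.inl hx))
    exact ⟨2, by decide, (z_lo x a (.inl hx) ha hxa (hzga x a hx ha)).mono (by decide),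
      (hzg x hx).mono (by decide)⟩
  · by_cases hlo : ∃ a, k a = .a ∧ G.Adj x a ∧ c x a = 2
    · have hhi := zb_hi x hx hlo
      obtain ⟨a, ha, hxa, h2⟩ := hlo
      exact ⟨2, by decide, (z_lo x a (.inr hx) ha hxa h2).mono (by decide), hhi.mono (by decide)⟩
    · rcases hzb x hx with h | h | h | h
      · exact absurd h.1 hlo
      · obtain ⟨h, y, hy, hxy, a, ha, hya, h2⟩ := h
        -- All edges from `x` to `a` have been switched, so the low walk starts inside `zb` with
        -- colour 3, raising the threshold.
        exact ⟨3, by decide, (z_lo y a (.inr hy) ha hya h2).cons hxy (hzbzb x y hx hy)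
          (by decide) (by decide), (z_hi x h).mono (by decide)⟩
      · exact absurd h.1 hlo
      · exact absurd h.1 hlo

end Layering

/-! ### Verification for all classes -/

namespace Layering

variable {G : SimpleGraph V} {u v : V} {k : V → Layer}

/-- The coloured graph is rainbow connected if sets `A` and `B` as in `exists_marking_zb` are given
for both ends of the edge `uv`. -/
lemma rainbowConnectionNumber_le_nine [Finite V] (L : G.Layering u v k) (huv : G.Adj u v)
    (A B : Set V)
    (hA : ∀ a ∈ A, k a = .a ∧ ((∃ q, G.Adj a q ∧ (k q = .b ∨ k q = .y)) ∨
      ∃ a', k a' = .a ∧ G.Adj a a' ∧ ∃ q, G.Adj a' q ∧ k q = .b))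
    (hB : ∀ b ∈ B, k b = .b ∧ ∃ q, G.Adj b q ∧ k q = .a)
    (hTA : ∀ z, k z = .zb → (∀ q, G.Adj z q → k q ≠ .zg) →
      (∃ a ∈ A, G.Adj z a) ∨ ∃ y, k y = .zb ∧ G.Adj z y ∧ ∃ a ∈ A, G.Adj y a)
    (hTB : ∀ z, k z = .wb → (∀ q, G.Adj z q → k q ≠ .wg) →
      (∃ a ∈ B, G.Adj z a) ∨ ∃ y, k y = .wb ∧ G.Adj z y ∧ ∃ a ∈ B, G.Adj y a) :
    G.rainbowConnectionNumber ≤ 9 := by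
  classical
  have Ls := L.swap
  obtain ⟨HA, hHA, hHA'⟩ := L.exists_marking_a
  obtain ⟨HB, hHB, hHB'⟩ := Ls.exists_marking_a
  obtain ⟨EA, hEA, hEA'⟩ := L.exists_marking_zb A hTA
  obtain ⟨EB, hEB, hEB'⟩ := Ls.exists_marking_zb B
    (by simpa only [ne_eq, Layer.swap_eq_iff, Layer.swap_u, Layer.swap_a, Layer.swap_b,
      Layer.swap_y, Layer.swap_zg, Layer.swap_zb] using hTB)
  obtain ⟨EX, hEX, hEX', hEX''⟩ := L.exists_marking_x
  simp only [ne_eq, Layer.swap_eq_iff, Layer.swap_u, Layer.swap_a, Layer.swap_zg,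
    Layer.swap_zb] at hHB hHB' hEB'
  let F : V → V → Prop := fun p q =>
    k p = .a ∧ k q = .u ∧ p ∈ HA ∨ k p = .b ∧ k q = .v ∧ p ∈ HB ∨
    k p = .zb ∧ k q = .a ∧ EA p q ∨ k p = .wb ∧ k q = .b ∧ EB p q ∨
    k p = .x ∧ k q = .y ∧ EX p q
  let c : V → V → Fin 9 := fun p q =>
    if F p q ∨ F q p then flipColor ((k p).color (k q)) else (k p).color (k q)
  have hc : ∀ p q, c p q = c q p := fun p q => by
    simp only [c, or_comm, Layer.color_comm (k p)]
  have hku : k u = .u := (L.u_iff u).2 rfl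
  have hkv : k v = .v := (L.v_iff v).2 rfl
  have hcol : ∀ p q i j, k p = i → k q = j →
      (i, j) ∉ ([(.a, .u), (.u, .a), (.b, .v), (.v, .b), (.zb, .a), (.a, .zb), (.wb, .b),
        (.b, .wb), (.x, .y), (.y, .x)] : List (Layer × Layer)) → c p q = i.color j := by
    rintro p q i j rfl rfl hij
    refine if_neg ?_
    rintro ((h | h | h | h | h) | (h | h | h | h | h)) <;> simp [h.1, h.2.1] at hij
  have cau : ∀ p, k p = .a → c p u = if p ∈ HA then 8 else 1 := fun p hp => by
    simp [c, F, hp, hku, Layer.color, flipColor]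
  have cbv : ∀ p, k p = .b → c p v = if p ∈ HB then 1 else 8 := fun p hp => by
    simp [c, F, hp, hkv, Layer.color, flipColor]
  have cza : ∀ p q, k p = .zb → k q = .a → c p q = if EA p q then 7 else 2 := fun p q hp hq => by
    simp [c, F, hp, hq, Layer.color, flipColor]
  have cwb : ∀ p q, k p = .wb → k q = .b → c p q = if EB p q then 2 else 7 := fun p q hp hq => by
    simp [c, F, hp, hq, Layer.color, flipColor]
  have cxy : ∀ p q, k p = .x → k q = .y → c p q = if EX p q then 7 else 2 := fun p q hp hq => by
    simp [c, F, hp, hq, Layer.color, flipColor]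
  have a_lo : ∀ a q, k a = .a → G.Adj a q → k q ≠ .u → k q ≠ .a →
      G.ColorReach c {u, v} {1} a := fun a q ha haq h h' =>
    (ColorReach.refl (by simp) (S := ∅)).cons (L.adj_u a ha)
      (by rw [cau a ha, if_neg (hHA a ha ⟨q, haq, h, h'⟩)]) (by decide) (by decide)
  have b_hi : ∀ b q, k b = .b → G.Adj b q → k q ≠ .v → k q ≠ .b →
      G.ColorReach c {u, v} {8} b := fun b q hb hbq h h' =>
    (ColorReach.refl (by simp) (S := ∅)).cons (L.adj_v b hb)
      (by rw [cbv b hb, if_neg (hHB b hb ⟨q, hbq, h, h'⟩)]) (by decide) (by decide)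
  have zg_lo : ∀ z, k z = .zg → G.ColorReach c {u, v} {1, 2} z := by
    intro z hz
    obtain ⟨a, hza, ha⟩ := L.toA z (.inr (.inl hz))
    exact (a_lo a z ha hza.symm (by simp [hz]) (by simp [hz])).cons hza
      (hcol _ _ _ _ hz ha (by decide)) (by decide) (by decide)
  have wg_hi : ∀ z, k z = .wg → G.ColorReach c {u, v} {7, 8} z := by
    intro z hz
    obtain ⟨b, hzb, hb⟩ := L.toB z (.inr (.inl hz))
    exact (b_hi b z hb hzb.symm (by simp [hz]) (by simp [hz])).cons hzb
      (hcol _ _ _ _ hz hb (by decide)) (by decide) (by decide)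
  have y_lo : ∀ y, k y = .y → G.ColorReach c {u, v} {1, 4} y := by
    intro y hy
    obtain ⟨a, hya, ha⟩ := L.toA y (.inl hy)
    exact (a_lo a y ha hya.symm (by simp [hy]) (by simp [hy])).cons hya
      (hcol _ _ _ _ hy ha (by decide)) (by decide) (by decide)
  have y_hi : ∀ y, k y = .y → G.ColorReach c {u, v} {6, 8} y := by
    intro y hy
    obtain ⟨b, hyb, hb⟩ := L.toB y (.inl hy)
    exact (b_hi b y hb hyb.symm (by simp [hy]) (by simp [hy])).cons hyb
      (hcol _ _ _ _ hy hb (by decide)) (by decide) (by decide)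
  have xz_lo : ∀ x, k x = .x → (∃ q, G.Adj x q ∧ k q = .zg) →
      G.ColorReach c {u, v} {1, 2, 3} x := fun x hx ⟨q, hxq, hq⟩ =>
    (zg_lo q hq).cons hxq (hcol _ _ _ _ hx hq (by decide)) (by decide) (by decide)
  have xw_hi : ∀ x, k x = .x → (∃ q, G.Adj x q ∧ k q = .wg) →
      G.ColorReach c {u, v} {6, 7, 8} x := fun x hx ⟨q, hxq, hq⟩ =>
    (wg_hi q hq).cons hxq (hcol _ _ _ _ hx hq (by decide)) (by decide) (by decide)
  have xy_lo : ∀ x, k x = .x → (∃ y, k y = .y ∧ G.Adj x y ∧ ¬ EX x y) →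
      G.ColorReach c {u, v} {1, 2, 4} x := fun x hx ⟨y, hy, hxy, hE⟩ =>
    (y_lo y hy).cons hxy (by rw [cxy x y hx hy, if_neg hE]) (by decide) (by decide)
  have xy_hi : ∀ x, k x = .x → (∃ y, k y = .y ∧ G.Adj x y ∧ EX x y) →
      G.ColorReach c {u, v} {6, 7, 8} x := fun x hx ⟨y, hy, hxy, hE⟩ =>
    (y_hi y hy).cons hxy (by rw [cxy x y hx hy, if_pos hE]) (by decide) (by decide)
  have x_lo : ∀ x, k x = .x → (∃ q, G.Adj x q ∧ k q = .zg) ∨ (∃ q, G.Adj x q ∧ k q = .wg) →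
      G.ColorReach c {u, v} {1, 2, 3, 4} x := by
    intro x hx h
    by_cases hz : ∃ q, G.Adj x q ∧ k q = .zg
    · exact (xz_lo x hx hz).mono (by decide)
    · obtain ⟨p, hxp, hp⟩ := L.x_near_u x hx
      have hp := hp.resolve_right fun hp => hz ⟨p, hxp, hp⟩
      exact (xy_lo x hx ⟨p, hp, hxp, hEX' x (h.resolve_left hz) hz p⟩).mono (by decide)
  have x_hi : ∀ x, k x = .x → (∃ q, G.Adj x q ∧ k q = .zg) ∨ (∃ q, G.Adj x q ∧ k q = .wg) →
      G.ColorReach c {u, v} {6, 7, 8} x := by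
    intro x hx h
    by_cases hw : ∃ q, G.Adj x q ∧ k q = .wg
    · exact xw_hi x hx hw
    · obtain ⟨p, hxp, hp⟩ := L.x_near_v x hx
      have hp := hp.resolve_right fun hp => hw ⟨p, hxp, hp⟩
      exact xy_hi x hx ⟨p, hp, hxp, hEX x (h.resolve_right hw) p⟩
  have zg_hi : ∀ z, k z = .zg → G.ColorReach c {u, v} {3, 4, 6, 7, 8} z := by
    intro z hz
    obtain ⟨p, hzp, hp | hp | hp⟩ := L.zg_adj z hz
    · exact (y_hi p hp).cons hzp (hcol _ _ _ _ hz hp (by decide)) (by decide) (by decide)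
    · exact (wg_hi p hp).cons hzp (hcol _ _ _ _ hz hp (by decide)) (by decide) (by decide)
    · exact (x_hi p hp (.inl ⟨z, hzp.symm, hz⟩)).cons hzp (hcol _ _ _ _ hz hp (by decide))
        (by decide) (by decide)
  have wg_lo : ∀ z, k z = .wg → G.ColorReach c {u, v} {1, 2, 3, 4, 6} z := by
    intro z hz
    obtain ⟨p, hzp, hp | hp | hp⟩ := L.wg_adj z hz
    · exact (y_lo p hp).cons hzp (hcol _ _ _ _ hz hp (by decide)) (by decide) (by decide)
    · exact (zg_lo p hp).cons hzp (hcol _ _ _ _ hz hp (by decide)) (by decide) (by decide)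
    · exact (x_lo p hp (.inr ⟨z, hzp.symm, hz⟩)).cons hzp (hcol _ _ _ _ hz hp (by decide))
        (by decide) (by decide)
  have ab_hi : ∀ a, k a = .a → (∃ q, G.Adj a q ∧ k q = .b) →
      G.ColorReach c {u, v} {4, 8} a := fun a ha ⟨q, haq, hq⟩ =>
    (b_hi q a hq haq.symm (by simp [ha]) (by simp [ha])).cons haq
      (hcol _ _ _ _ ha hq (by decide)) (by decide) (by decide)
  have ba_lo : ∀ b, k b = .b → (∃ q, G.Adj b q ∧ k q = .a) →
      G.ColorReach c {u, v} {1, 4} b := fun b hb ⟨q, hbq, hq⟩ =>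
    (a_lo q b hq hbq.symm (by simp [hb]) (by simp [hb])).cons hbq
      (hcol _ _ _ _ hb hq (by decide)) (by decide) (by decide)
  have a_hi : ∀ a, k a = .a → (∃ q, G.Adj a q ∧ (k q = .b ∨ k q = .y)) →
      G.ColorReach c {u, v} {4, 6, 8} a := by
    rintro a ha ⟨q, haq, hq | hq⟩
    · exact (ab_hi a ha ⟨q, haq, hq⟩).mono (by decide)
    · exact (y_hi q hq).cons haq (hcol _ _ _ _ ha hq (by decide)) (by decide) (by decide)
  have b_lo : ∀ b, k b = .b → (∃ q, G.Adj b q ∧ (k q = .a ∨ k q = .y)) →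
      G.ColorReach c {u, v} {1, 4, 6} b := by
    rintro b hb ⟨q, hbq, hq | hq⟩
    · exact (ba_lo b hb ⟨q, hbq, hq⟩).mono (by decide)
    · exact (y_lo q hq).cons hbq (hcol _ _ _ _ hb hq (by decide)) (by decide) (by decide)
  -- Colours 7 and 3 stay free for a marked edge from `zb` to `A`, preceded by an edge inside `zb`.
  have A_hi : ∀ a ∈ A, G.ColorReach c {u, v} {4, 5, 6, 8} a := by
    intro a ha
    obtain ⟨ha, h | ⟨a', ha', haa', h⟩⟩ := hA a ha
    · exact (a_hi a ha h).mono (by decide)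
    · exact (ab_hi a' ha' h).cons haa' (hcol _ _ _ _ ha ha' (by decide)) (by decide) (by decide)
  have hside : ∀ x, k x = .a ∨ k x = .zg ∨ k x = .zb → G.SideCut c {u, v} x := by
    refine L.sideCut hc (by simp) (A := A) ?_ ?_ ?_ ?_ ?_ ?_ ?_ ?_ ?_ A_hi zg_hi
    · intro a ha h
      rw [cau a ha, if_neg (hHA a ha h)]
    · intro a ha h
      obtain ⟨a', ha', haa', h⟩ := hHA' a ha h
      exact ⟨a', ha', haa', by simpa [cau a ha, cau a' ha'] using h⟩
    · exact fun p q hp hq => hcol _ _ _ _ hp hq (by decide)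
    · exact fun p q hp hq => hcol _ _ _ _ hp hq (by decide)
    · exact fun p q hp hq => hcol _ _ _ _ hp hq (by decide)
    · exact fun p q hp hq => hcol _ _ _ _ hp hq (by decide)
    · intro p q hp hq hqA
      rw [cza p q hp hq, if_neg fun h => hqA (hEA p q h)]
    · have hlo : ∀ z, k z = .zb → (∃ a, k a = .a ∧ G.Adj z a ∧ ¬ EA z a) →
          ∃ a, k a = .a ∧ G.Adj z a ∧ c z a = 2 := fun z hz ⟨a, ha, hza, h⟩ =>
        ⟨a, ha, hza, by rw [cza z a hz ha, if_neg h]⟩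
      have hhi : ∀ z, k z = .zb → (∃ a, G.Adj z a ∧ EA z a) →
          ∃ a ∈ A, G.Adj z a ∧ c z a = 7 := fun z hz ⟨a, hza, h⟩ =>
        ⟨a, hEA z a h, hza, by rw [cza z a hz (hA a (hEA z a h)).1, if_pos h]⟩
      intro z hz
      rcases hEA' z hz with ⟨h, h'⟩ | ⟨h, y, hy, hzy, h'⟩ | ⟨h, h'⟩ | ⟨h, y, hy, hzy, h'⟩
      · exact .inl ⟨hlo z hz h, hhi z hz h'⟩
      · exact .inr (.inl ⟨hhi z hz h, y, hy, hzy, hlo y hy h'⟩)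
      · exact .inr (.inr (.inl ⟨hlo z hz h, h'⟩))
      · exact .inr (.inr (.inr ⟨hlo z hz h, y, hy, hzy, hhi y hy h'⟩))
    · exact fun a ha h => (a_hi a ha h).mono (by decide)
  have hside' : ∀ x, k x = .b ∨ k x = .wg ∨ k x = .wb → G.SideCut c {u, v} x := by
    intro x hx
    refine SideCut.of_flip (Ls.sideCut (fun p q => congrArg flipColor (hc p q)) (by simp)
      (A := B) ?_ ?_ ?_ ?_ ?_ ?_ ?_ ?_ ?_ ?_ ?_ x ?_) <;>
    simp only [ne_eq, Layer.swap_eq_iff, Layer.swap_u, Layer.swap_a, Layer.swap_b,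
      Layer.swap_y, Layer.swap_zg, Layer.swap_zb,
      ColorReach.comp_iff flipColor_involutive]
    · intro a ha h
      rw [cbv a ha, if_neg (hHB a ha h)]
      rfl
    · intro a ha h
      obtain ⟨a', ha', haa', h⟩ := hHB' a ha h
      refine ⟨a', ha', haa', ?_⟩
      rw [cbv a ha, cbv a' ha']
      rcases h with h | h <;> simp [h, flipColor]
    · exact fun p q hp hq => congrArg flipColor (hcol _ _ _ _ hp hq (by decide))
    · exact fun p q hp hq => congrArg flipColor (hcol _ _ _ _ hp hq (by decide))
    · exact fun p q hp hq => congrArg flipColor (hcol _ _ _ _ hp hq (by decide))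
    · exact fun p q hp hq => congrArg flipColor (hcol _ _ _ _ hp hq (by decide))
    · intro p q hp hq hqA
      rw [cwb p q hp hq, if_neg fun h => hqA (hEB p q h)]
      rfl
    · have hlo : ∀ z, k z = .wb → (∃ a, k a = .b ∧ G.Adj z a ∧ ¬ EB z a) →
          ∃ a, k a = .b ∧ G.Adj z a ∧ flipColor (c z a) = 2 := fun z hz ⟨a, ha, hza, h⟩ =>
        ⟨a, ha, hza, by rw [cwb z a hz ha, if_neg h]; rfl⟩
      have hhi : ∀ z, k z = .wb → (∃ a, G.Adj z a ∧ EB z a) →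
          ∃ a ∈ B, G.Adj z a ∧ flipColor (c z a) = 7 := fun z hz ⟨a, hza, h⟩ =>
        ⟨a, hEB z a h, hza, by rw [cwb z a hz (hB a (hEB z a h)).1, if_pos h]; rfl⟩
      intro z hz
      rcases hEB' z hz with ⟨h, h'⟩ | ⟨h, y, hy, hzy, h'⟩ | ⟨h, h'⟩ | ⟨h, y, hy, hzy, h'⟩
      · exact .inl ⟨hlo z hz h, hhi z hz h'⟩
      · exact .inr (.inl ⟨hhi z hz h, y, hy, hzy, hlo y hy h'⟩)
      · exact .inr (.inr (.inl ⟨hlo z hz h, h'⟩))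
      · exact .inr (.inr (.inr ⟨hlo z hz h, y, hy, hzy, hhi y hy h'⟩))
    · exact fun b hb h => (b_lo b hb h).mono (by decide)
    -- Here `B` must be narrower than `A`: the edges from `b` to `y` have colour 6, mirrored to 3,
    -- which the edges inside `wb` already use.
    · exact fun b hb => (ba_lo b (hB b hb).1 (hB b hb).2).mono (by decide)
    · exact fun z hz => (wg_lo z hz).mono (by decide)
    · exact hx
  have hcut : ∀ x, G.SideCut c {u, v} x → ∃ t : Fin 9,
      G.ColorReach c {u, v} (Finset.Ioc 0 t) x ∧ G.ColorReach c {u, v} (Finset.Ioi t) x :=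
    fun x ⟨t, _, h⟩ => ⟨t, h⟩
  refine G.rainbowConnectionNumber_le_nine_of_cut huv c hc
    (hcol _ _ _ _ hku hkv (by decide)) fun x hxu hxv => ?_
  cases hx : k x with
  | u => exact absurd ((L.u_iff x).1 hx) hxu
  | v => exact absurd ((L.v_iff x).1 hx) hxv
  | a => exact hcut x (hside x (.inl hx))
  | zg => exact hcut x (hside x (.inr (.inl hx)))
  | zb => exact hcut x (hside x (.inr (.inr hx)))
  | b => exact hcut x (hside' x (.inl hx))
  | wg => exact hcut x (hside' x (.inr (.inl hx)))
  | wb => exact hcut x (hside' x (.inr (.inr hx)))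
  | y => exact ⟨4, (y_lo x hx).mono (by decide), (y_hi x hx).mono (by decide)⟩
  | x =>
    by_cases h : (∃ q, G.Adj x q ∧ k q = .zg) ∨ ∃ q, G.Adj x q ∧ k q = .wg
    · exact ⟨4, (x_lo x hx h).mono (by decide), (x_hi x hx h).mono (by decide)⟩
    · push Not at h
      rcases hEX'' x hx (by simpa using h.1) (by simpa using h.2) with
        ⟨h, h'⟩ | ⟨h, y, hy, hxy, h'⟩ | ⟨h, y, hy, hxy, h'⟩
      · exact ⟨4, (xy_lo x hx h).mono (by decide), (xy_hi x hx h').mono (by decide)⟩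
      -- The edge inside `x` has colour 5 and is on the low walk here, on the high walk in the next
      -- case.
      · exact ⟨5, (xy_lo y hy h').cons hxy (hcol _ _ _ _ hx hy (by decide)) (by decide)
          (by decide), (xy_hi x hx h).mono (by decide)⟩
      · refine ⟨4, (xy_lo x hx h).mono (by decide), ?_⟩
        have hyhi : G.ColorReach c {u, v} {6, 7, 8} y :=
          h'.elim (xy_hi y hy) (x_hi y hy)
        exact hyhi.cons hxy (hcol _ _ _ _ hx hy (by decide)) (by decide) (by decide)

end Layering

/-! ### Obtaining the classes -/

/-- If y were the only neighbour of x, deleting `xy` would isolate x, making the edge a bridge. -/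
lemma IsBridgeless.exists_ne {G : SimpleGraph V} (h : G.IsBridgeless) {x y : V} (hxy : G.Adj x y) :
    ∃ z, z ≠ y ∧ G.Adj x z := by
  by_contra! hno
  refine h s(x, y) hxy (isBridge_iff.2 ?_)
  rintro ⟨p⟩
  cases p with
  | nil => exact G.loopless.irrefl _ hxy
  | cons hxz p =>
    rw [deleteEdges_adj] at hxz
    rename_i z
    by_cases hz : z = y
    · exact hxz.2 (by simp [hz])
    · exact hno z hz hxz.1

lemma exists_of_walk_length_le_three {G : SimpleGraph V} {x y : V} (p : G.Walk x y)
    (hp : p.length ≤ 3) :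
    ∃ p q, (x = p ∨ G.Adj x p) ∧ (p = q ∨ G.Adj p q) ∧ (q = y ∨ G.Adj q y) := by
  match p with
  | .nil => exact ⟨x, x, .inl rfl, .inl rfl, .inl rfl⟩
  | .cons h .nil => exact ⟨x, x, .inl rfl, .inl rfl, .inr h⟩
  | .cons h (.cons h' .nil) => exact ⟨x, _, .inl rfl, .inr h, .inr h'⟩
  | .cons h (.cons h' (.cons h'' .nil)) => exact ⟨_, _, .inr h, .inr h', .inr h''⟩
  | .cons _ (.cons _ (.cons _ (.cons _ _))) => simp at hp; omega

lemma exists_layering {G : SimpleGraph V} {u v : V} (huv : G.Adj u v)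
    (htri : ∀ w, G.Adj u w → ¬ G.Adj v w)
    (hdeg : ∀ x y, G.Adj x y → ∃ z, z ≠ y ∧ G.Adj x z)
    (hdist : ∀ x y, ∃ p q, (x = p ∨ G.Adj x p) ∧ (p = q ∨ G.Adj p q) ∧ (q = y ∨ G.Adj q y)) :
    ∃ k, G.Layering u v k := by
  classical
  obtain ⟨NA, hNA⟩ : ∃ S : Set V, ∀ x, x ∈ S ↔ ∃ a, G.Adj x a ∧ G.Adj u a ∧ a ≠ v :=
    ⟨{x | _}, fun _ => Iff.rfl⟩
  obtain ⟨NB, hNB⟩ : ∃ S : Set V, ∀ x, x ∈ S ↔ ∃ b, G.Adj x b ∧ G.Adj v b ∧ b ≠ u :=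
    ⟨{x | _}, fun _ => Iff.rfl⟩
  -- For a vertex adjacent to `a` but not to `b`, and outside all earlier classes, such a neighbour
  -- p lies in `y`, `wg` or `x`.
  obtain ⟨ZG, hZG⟩ : ∃ S : Set V, ∀ x, x ∈ S ↔ ∃ p, G.Adj x p ∧ ¬ G.Adj u p ∧ (p ∈ NA → p ∈ NB) :=
    ⟨{x | _}, fun _ => Iff.rfl⟩
  obtain ⟨WG, hWG⟩ : ∃ S : Set V, ∀ x, x ∈ S ↔ ∃ p, G.Adj x p ∧ ¬ G.Adj v p ∧ (p ∈ NB → p ∈ NA) :=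
    ⟨{x | _}, fun _ => Iff.rfl⟩
  obtain ⟨k, hk⟩ : ∃ k : V → Layer, ∀ x, k x =
      if x = u then .u else if x = v then .v else if G.Adj u x then .a else if G.Adj v x then .b
      else if x ∈ NA then (if x ∈ NB then .y else if x ∈ ZG then .zg else .zb)
      else if x ∈ NB then (if x ∈ WG then .wg else .wb) else .x := ⟨_, fun _ => rfl⟩
  have hirr : ∀ x, ¬ G.Adj x x := G.loopless.irrefl
  have hne : u ≠ v := huv.ne
  have hu : ∀ x, k x = .u ↔ x = u := by
    clear hdeg hdist hNA hNB hZG hWG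
    grind
  have hv : ∀ x, k x = .v ↔ x = v := by
    clear hdeg hdist hNA hNB hZG hWG
    grind
  have ha : ∀ x, k x = .a ↔ G.Adj u x ∧ x ≠ v := by
    clear hdeg hdist hNA hNB hZG hWG
    grind
  have hb : ∀ x, k x = .b ↔ G.Adj v x ∧ x ≠ u := by
    clear hdeg hdist hNA hNB hZG hWG
    grind
  have hy : ∀ x, k x = .y ↔ x ≠ u ∧ x ≠ v ∧ ¬ G.Adj u x ∧ ¬ G.Adj v x ∧ x ∈ NA ∧ x ∈ NB := by
    clear hdeg hdist hNA hNB hZG hWG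
    grind
  have hzg : ∀ x, k x = .zg ↔ x ≠ u ∧ x ≠ v ∧ ¬ G.Adj u x ∧ ¬ G.Adj v x ∧ x ∈ NA ∧ x ∉ NB ∧
      x ∈ ZG := by
    clear hdeg hdist hNA hNB hZG hWG
    grind
  have hzb : ∀ x, k x = .zb ↔ x ≠ u ∧ x ≠ v ∧ ¬ G.Adj u x ∧ ¬ G.Adj v x ∧ x ∈ NA ∧ x ∉ NB ∧
      x ∉ ZG := by
    clear hdeg hdist hNA hNB hZG hWG
    grind
  have hwg : ∀ x, k x = .wg ↔ x ≠ u ∧ x ≠ v ∧ ¬ G.Adj u x ∧ ¬ G.Adj v x ∧ x ∉ NA ∧ x ∈ NB ∧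
      x ∈ WG := by
    clear hdeg hdist hNA hNB hZG hWG
    grind
  have hwb : ∀ x, k x = .wb ↔ x ≠ u ∧ x ≠ v ∧ ¬ G.Adj u x ∧ ¬ G.Adj v x ∧ x ∉ NA ∧ x ∈ NB ∧
      x ∉ WG := by
    clear hdeg hdist hNA hNB hZG hWG
    grind
  have hx : ∀ x, k x = .x ↔ x ≠ u ∧ x ≠ v ∧ ¬ G.Adj u x ∧ ¬ G.Adj v x ∧ x ∉ NA ∧ x ∉ NB := by
    clear hdeg hdist hNA hNB hZG hWG
    grind
  have hsymm : ∀ x y, G.Adj x y → G.Adj y x := fun x y h => h.symm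
  clear hk
  have mA : ∀ x a, G.Adj x a → G.Adj u a → a ≠ v → x ∈ NA :=
    fun x a h h' h'' => (hNA x).2 ⟨a, h, h', h''⟩
  have mB : ∀ x b, G.Adj x b → G.Adj v b → b ≠ u → x ∈ NB :=
    fun x b h h' h'' => (hNB x).2 ⟨b, h, h', h''⟩
  have mZ : ∀ x p, G.Adj x p → ¬ G.Adj u p → (p ∈ NA → p ∈ NB) → x ∈ ZG :=
    fun x p h h' h'' => (hZG x).2 ⟨p, h, h', h''⟩
  have mW : ∀ x p, G.Adj x p → ¬ G.Adj v p → (p ∈ NB → p ∈ NA) → x ∈ WG :=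
    fun x p h h' h'' => (hWG x).2 ⟨p, h, h', h''⟩
  refine ⟨k, hu, hv, fun x h => ((ha x).1 h).1.symm, fun x h => ((hb x).1 h).1.symm,
    ?_, ?_, ?_, ?_, ?_, ?_, ?_, hdeg, hdist⟩
  · intro x h
    obtain ⟨a, hxa, h⟩ := (hNA x).1 (by clear hdeg hdist; grind)
    exact ⟨a, hxa, (ha a).2 h⟩
  · intro x h
    obtain ⟨b, hxb, h⟩ := (hNB x).1 (by clear hdeg hdist; grind)
    exact ⟨b, hxb, (hb b).2 h⟩
  · intro x h
    obtain ⟨hxu, hxv, hux, hvx, hxA, hxB⟩ := (hx x).1 h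
    obtain ⟨p, q, h1, h2, h3⟩ := hdist x u
    clear hdeg hdist
    have hxp : G.Adj x p := by grind
    have hpu : ¬ G.Adj u p := by grind
    have hpv : ¬ G.Adj v p := by grind
    have hpNA : p ∈ NA := by grind
    by_cases hp : p ∈ NB
    · exact ⟨p, hxp, .inl ((hy p).2 (by grind))⟩
    · exact ⟨p, hxp, .inr ((hzg p).2 (by grind))⟩
  · intro x h
    obtain ⟨hxu, hxv, hux, hvx, hxA, hxB⟩ := (hx x).1 h
    obtain ⟨p, q, h1, h2, h3⟩ := hdist x v
    clear hdeg hdist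
    have hxp : G.Adj x p := by grind
    have hpu : ¬ G.Adj u p := by grind
    have hpv : ¬ G.Adj v p := by grind
    have hpNB : p ∈ NB := by grind
    by_cases hp : p ∈ NA
    · exact ⟨p, hxp, .inl ((hy p).2 (by grind))⟩
    · exact ⟨p, hxp, .inr ((hwg p).2 (by grind))⟩
  · intro x h
    obtain ⟨hxu, hxv, hux, hvx, hxA, hxB, hxZG⟩ := (hzg x).1 h
    obtain ⟨p, hxp, hpu, hp⟩ := (hZG x).1 hxZG
    clear hdeg hdist
    refine ⟨p, hxp, ?_⟩
    have hpv : ¬ G.Adj v p := by grind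
    by_cases hpA : p ∈ NA
    · exact .inl ((hy p).2 (by grind))
    by_cases hpB : p ∈ NB
    · exact .inr (.inl ((hwg p).2 (by grind)))
    · exact .inr (.inr ((hx p).2 (by grind)))
  · intro x h
    obtain ⟨hxu, hxv, hux, hvx, hxA, hxB, hxWG⟩ := (hwg x).1 h
    obtain ⟨p, hxp, hpu, hp⟩ := (hWG x).1 hxWG
    clear hdeg hdist
    refine ⟨p, hxp, ?_⟩
    have hpv : ¬ G.Adj u p := by grind
    by_cases hpA : p ∈ NB
    · exact .inl ((hy p).2 (by grind))
    by_cases hpB : p ∈ NA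
    · exact .inr (.inl ((hzg p).2 (by grind)))
    · exact .inr (.inr ((hx p).2 (by grind)))
  · intro p q hpq
    clear hdeg hdist hNA hNB hZG hWG
    cases hp : k p <;> cases hq : k q <;> simp only [Layer.compat] <;> first | decide | (exfalso; grind)

/-! ### Choice of the exit sets and conclusion -/

namespace Layering

variable {G : SimpleGraph V} {u v : V} {k : V → Layer}

lemma exists_b (L : G.Layering u v k) (huv : G.Adj u v) : ∃ b, k b = .b := by
  obtain ⟨b, hbu, hvb⟩ := L.exists_ne v u huv.symm
  have := L.compat v b hvb
  rw [(L.v_iff v).2 rfl] at this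
  simp only [Layer.compat, List.mem_cons, List.not_mem_nil, or_false] at this
  exact ⟨b, this.resolve_left fun h => hbu ((L.u_iff b).1 h)⟩

/-- No vertex of `wb` needs an exit, so `B` can be empty and `A` as large as the colouring permits;
the distance to a single vertex of `b` then suffices. -/
lemma rainbowConnectionNumber_le_nine_of_forall_wb [Finite V] (L : G.Layering u v k)
    (huv : G.Adj u v) (hw : ∀ w, k w = .wb → ∃ q, G.Adj w q ∧ k q = .wg) :
    G.rainbowConnectionNumber ≤ 9 := by
  obtain ⟨b, hb⟩ := L.exists_b huv
  refine L.rainbowConnectionNumber_le_nine huv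
    {a | k a = .a ∧ ((∃ q, G.Adj a q ∧ (k q = .b ∨ k q = .y)) ∨
      ∃ a', k a' = .a ∧ G.Adj a a' ∧ ∃ q, G.Adj a' q ∧ k q = .b)} ∅ (fun _ h => h) (by simp)
    ?_ ?_
  · intro z hz hzg
    rcases L.zb_near_b hz hzg hb with ⟨a, ha, hza, h⟩ | ⟨y, hy, hzy, a, ha, hya, q, haq, hq⟩
    · exact .inl ⟨a, ⟨ha, h⟩, hza⟩
    · exact .inr ⟨y, hy, hzy, a, ⟨ha, .inl ⟨q, haq, .inl hq⟩⟩, hya⟩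
  · intro z hz hzg
    obtain ⟨q, hzq, hq⟩ := hw z hz
    exact absurd hq (hzg q hzq)

/-- If both sides contain a vertex in need of an exit, the distance from it to those on the other
side forces edges between `a` and `b`, so the narrow choice works for `A` and `B` alike. -/
lemma rainbowConnectionNumber_le_nine_of_layering [Finite V] (L : G.Layering u v k)
    (huv : G.Adj u v) : G.rainbowConnectionNumber ≤ 9 := by
  by_cases hw : ∀ w, k w = .wb → ∃ q, G.Adj w q ∧ k q = .wg
  · exact L.rainbowConnectionNumber_le_nine_of_forall_wb huv hw
  by_cases hz : ∀ z, k z = .zb → ∃ q, G.Adj z q ∧ k q = .zg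
  · refine L.swap.rainbowConnectionNumber_le_nine_of_forall_wb huv.symm ?_
    simp only [Layer.swap_eq_iff]
    exact hz
  push Not at hw hz
  obtain ⟨w, hw, hwg⟩ := hw
  obtain ⟨z, hz, hzg⟩ := hz
  refine L.rainbowConnectionNumber_le_nine huv {a | k a = .a ∧ ∃ q, G.Adj a q ∧ k q = .b}
    {b | k b = .b ∧ ∃ q, G.Adj b q ∧ k q = .a} ?_ (fun _ h => h) ?_ ?_
  · rintro a ⟨ha, q, haq, hq⟩
    exact ⟨ha, .inl ⟨q, haq, .inl hq⟩⟩
  · intro z hz hzg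
    obtain ⟨a, b, ha, hb, hza, hab, -⟩ := L.zb_near_wb hz hzg hw hwg
    exact .inl ⟨a, ⟨ha, b, hab, hb⟩, hza⟩
  · intro w hw hwg
    obtain ⟨a, b, ha, hb, -, hab, hwb⟩ := L.zb_near_wb hz hzg hw hwg
    exact .inl ⟨b, ⟨hb, a, hab.symm, ha⟩, hwb⟩

end Layering

end SimpleGraph

theorem theorem5 {V : Type*} [Finite V] (G : SimpleGraph V)
    (hbridgeless : G.IsBridgeless) (hdiam : G.diam = 3)
    (hedge : ∃ u v : V, G.Adj u v ∧ ¬ ∃ w : V, G.Adj u w ∧ G.Adj v w) :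
    G.rainbowConnectionNumber ≤ 9 := by
  obtain ⟨u, v, huv, htri⟩ := hedge
  -- `diam` is 0 when the extended diameter is infinite, so the value 3 implies connectedness.
  have htop : G.ediam ≠ ⊤ := G.ediam_ne_top_of_diam_ne_zero (by omega)
  obtain ⟨k, L⟩ := SimpleGraph.exists_layering huv (fun w h h' => htri ⟨w, h, h'⟩)
    (fun x y => hbridgeless.exists_ne) (fun x y => by
      obtain ⟨p, hp⟩ := (G.preconnected_of_ediam_ne_top htop x y).exists_walk_length_eq_dist
      exact SimpleGraph.exists_of_walk_length_le_three p
        (hp.trans_le ((G.dist_le_diam htop).trans_eq hdiam)))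
  exact L.rainbowConnectionNumber_le_nine_of_layering huv
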